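/- Let $X$ be a real $n\times p$ matrix of rank $r$, let $\sigma>0$ be known, and for $\beta\in\mathbb{R}^p$ consider the Gaussian linear regression model $y=X\beta+\varepsilon$ with $\varepsilon\sim N(0,\sigma^2 I_n)$. Let $\|\beta\|_0$ be the number of nonzero entries of $\beta$ and $\|\cdot\|$ the Euclidean norm. For $1\le k\le r$ let $$\phi_{\min}[k]=\min_{1\le\|\beta\|_0\le k}\frac{\|X\beta\|^2}{\|\beta\|^2},\qquad \phi_{\max}[k]=\max_{1\le\|\beta\|_0\le k}\frac{\|X\beta\|^2}{\|\beta\|^2},\qquad \tau[k]=\frac{\phi_{\min}[k]}{\phi_{\max}[k]}.$$ There exists a universal constant $C_2>0$ (not depending on $n$, $p$, $X$, $\sigma$ or $p_0$) such that for every such $n,p,X,\sigma$ and every integer $p_0$ with $1\le p_0\le r$, $$\inf_{\hat y}\ \sup_{\beta:\|\beta\|_0\le p_0}E\|\hat y-X\beta\|^2\ \ge\ \begin{cases} C_2\,\sigma^2\,\tau[2p_0]\,p_0\left(\ln(p/p_0)+1\right), & 1\le p_0\le r/2,\\ C_2\,\sigma^2\,\tau[p_0]\,r, & r/2\le p_0\le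 r,\end{cases}$$ where the infimum is taken over all estimators $\hat y=\hat y(y)$ of the mean vector $X\beta$, that is, all measurable functions of the observation $y$ (for $p_0=r/2$ both bounds hold). -/

import Mathlib

open MeasureTheory ProbabilityTheory
open scoped ENNReal

noncomputable section

namespace SparseRegression

/-- The mean vector `Xβ`, as a vector of `ℝⁿ` with the Euclidean norm. -/
def meanVec {n p : ℕ} (X : Matrix (Fin n) (Fin p) ℝ) (β : EuclideanSpace ℝ (Fin p)) :
    EuclideanSpace ℝ (Fin n) :=
  WithLp.toLp 2 (X.mulVec β.ofLp)

/-- The `ℓ₀` quasi-norm `‖β‖₀`: the number of nonzero entries of `β`. -/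
def l0norm {p : ℕ} (β : EuclideanSpace ℝ (Fin p)) : ℕ := hammingNorm β.ofLp

/-- The Rayleigh quotients `‖Xβ‖² / ‖β‖²` over all `β` with `1 ≤ ‖β‖₀ ≤ k`. -/
def sparseQuotients {n p : ℕ} (X : Matrix (Fin n) (Fin p) ℝ) (k : ℕ) : Set ℝ :=
  {q | ∃ β : EuclideanSpace ℝ (Fin p), 1 ≤ l0norm β ∧ l0norm β ≤ k ∧
    q = ‖meanVec X β‖ ^ 2 / ‖β‖ ^ 2}

/-- The `k`-sparse minimal eigenvalue of the design. -/
def phiMin {n p : ℕ} (X : Matrix (Fin n) (Fin p) ℝ) (k : ℕ) : ℝ := sInf (sparseQuotients X k)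

/-- The `k`-sparse maximal eigenvalue of the design. -/
def phiMax {n p : ℕ} (X : Matrix (Fin n) (Fin p) ℝ) (k : ℕ) : ℝ := sSup (sparseQuotients X k)

/-- The ratio `τ[k] = φ_min[k] / φ_max[k]` for `k ≤ r = rank X`, and `τ[k] = τ[r]` for `k > r`. -/
def tau {n p : ℕ} (X : Matrix (Fin n) (Fin p) ℝ) (k : ℕ) : ℝ :=
  phiMin X (min k X.rank) / phiMax X (min k X.rank)

/-- The law of the observation `y = Xβ + ε`, `ε ∼ N(0, σ² Iₙ)`, where `ε = σ z` with `z` a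
standard Gaussian vector. -/
def obsLaw {n p : ℕ} (X : Matrix (Fin n) (Fin p) ℝ) (σ : ℝ) (β : EuclideanSpace ℝ (Fin p)) :
    Measure (EuclideanSpace ℝ (Fin n)) :=
  (stdGaussian (EuclideanSpace ℝ (Fin n))).map (fun z => meanVec X β + σ • z)

/-- The quadratic risk `E ‖ŷ - Xβ‖²` (possibly infinite) of the estimator `yhat`. -/
def risk {n p : ℕ} (X : Matrix (Fin n) (Fin p) ℝ) (σ : ℝ)
    (yhat : EuclideanSpace ℝ (Fin n) → EuclideanSpace ℝ (Fin n))
    (β : EuclideanSpace ℝ (Fin p)) : ℝ≥0∞ :=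
  ∫⁻ y, ‖yhat y - meanVec X β‖ₑ ^ 2 ∂(obsLaw X σ β)

/-- The minimax risk of estimating `Xβ` over `‖β‖₀ ≤ p₀`; the infimum is over all estimators,
that is, all measurable functions of the observation (they may depend on `X`, `σ`, `p₀`). -/
def minimaxRisk {n p : ℕ} (X : Matrix (Fin n) (Fin p) ℝ) (σ : ℝ) (p₀ : ℕ) : ℝ≥0∞ :=
  ⨅ (yhat : EuclideanSpace ℝ (Fin n) → EuclideanSpace ℝ (Fin n)) (_ : Measurable yhat),
    ⨆ (β : EuclideanSpace ℝ (Fin p)) (_ : l0norm β ≤ p₀), risk X σ yhat β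

end SparseRegression

end

namespace SparseRegression

/-! The bound comes from a finite subfamily of sparse vectors. Each of `p₀` disjoint blocks of
coordinates carries one of `m` patterns, scaled by `a`, and Assouad's lemma treats every block as a
test among `m` Gaussian means. With `a² ≍ σ² log m / φ_max`, changing one block moves the mean too
little for the data to reveal the pattern, so each block is misread with probability at least 3/20
on average. A misread block costs squared loss of order `φ_min a²`. Summing over blocks gives order
`σ² τ p₀ log m`. For `p₀ ≤ r/2` the patterns are the unit vectors of a block of size `m = ⌊p/p₀⌋`;
differences are `2p₀`-sparse, whence `τ[2p₀]`. For `p₀ ≥ r/2` each block is one coordinate, on or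
off; differences are `p₀`-sparse, and `r ≤ 2p₀` turns `p₀` into `r`. The test bound is
`sum_gaussianLocation_real_le`; `le_minimaxRisk_of_blocks` joins it to the design. -/

/-! ### Shifts of Gaussian measures. -/

lemma gaussianReal_eq_withDensity (h : ℝ) :
    gaussianReal h 1 = (gaussianReal 0 1).withDensity
      (fun x => ENNReal.ofReal (Real.exp (h * x - h ^ 2 / 2))) := by
  rw [gaussianReal_of_var_ne_zero _ one_ne_zero, gaussianReal_of_var_ne_zero _ one_ne_zero,
    ← withDensity_mul _ (measurable_gaussianPDF _ _) (by fun_prop)]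
  congr 1
  ext x
  simp only [Pi.mul_apply, gaussianPDF, gaussianPDFReal]
  rw [← ENNReal.ofReal_mul (by positivity), mul_assoc _ (Real.exp _), ← Real.exp_add]
  congr 3
  simp
  ring

lemma pi_gaussianReal_map_add {n : ℕ} (h : Fin n → ℝ) :
    (Measure.pi fun _ : Fin n => gaussianReal 0 1).map (fun z => z + h) =
      (Measure.pi fun _ : Fin n => gaussianReal 0 1).withDensity
        (fun z => ENNReal.ofReal (Real.exp (∑ i, (h i * z i - h i ^ 2 / 2)))) := by
  have h1 : (Measure.pi fun _ : Fin n => gaussianReal 0 1).map (fun z => z + h) =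
      Measure.pi fun i : Fin n => gaussianReal (h i) 1 := by
    have := Measure.pi_map_pi (μ := fun _ : Fin n => gaussianReal 0 1)
      (f := fun i x => x + h i) (fun i => by fun_prop)
    simp only [gaussianReal_map_add_const, zero_add] at this
    rw [← this]
    rfl
  rw [h1]
  refine Measure.pi_eq fun s hs => ?_
  rw [withDensity_apply _ (MeasurableSet.univ_pi hs), ← lintegral_indicator (MeasurableSet.univ_pi hs)]
  have key : ∀ z : Fin n → ℝ,
      (Set.univ.pi s).indicator
        (fun z => ENNReal.ofReal (Real.exp (∑ i, (h i * z i - h i ^ 2 / 2)))) z =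
      ∏ i, (s i).indicator (fun x => ENNReal.ofReal (Real.exp (h i * x - h i ^ 2 / 2))) (z i) := by
    intro z
    by_cases hz : z ∈ Set.univ.pi s
    · rw [Set.indicator_of_mem hz, Real.exp_sum,
        ENNReal.ofReal_prod_of_nonneg fun _ _ => (Real.exp_pos _).le]
      exact Finset.prod_congr rfl fun i _ =>
        (Set.indicator_of_mem (hz i (Set.mem_univ i)) (fun x : ℝ =>
          ENNReal.ofReal (Real.exp (h i * x - h i ^ 2 / 2)))).symm
    · rw [Set.indicator_of_notMem hz]
      obtain ⟨i, hi⟩ : ∃ i, z i ∉ s i := by simpa [Set.mem_pi] using hz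
      exact (Finset.prod_eq_zero (Finset.mem_univ i) (Set.indicator_of_notMem hi _)).symm
  simp_rw [key]
  have hm : ∀ i, Measurable
      ((s i).indicator fun x => ENNReal.ofReal (Real.exp (h i * x - h i ^ 2 / 2))) :=
    fun i => Measurable.indicator (by fun_prop) (hs i)
  have hind : iIndepFun (fun i (z : Fin n → ℝ) =>
      (s i).indicator (fun x => ENNReal.ofReal (Real.exp (h i * x - h i ^ 2 / 2))) (z i))
      (Measure.pi fun _ : Fin n => gaussianReal 0 1) :=
    iIndepFun_pi fun i => (hm i).aemeasurable
  rw [lintegral_prod_eq_prod_lintegral_of_indepFun _ _ hind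
    (fun i => (hm i).comp (measurable_pi_apply i))]
  refine Finset.prod_congr rfl fun i _ => ?_
  rw [(measurePreserving_eval (fun _ : Fin n => gaussianReal 0 1) i).lintegral_comp (hm i),
    lintegral_indicator (hs i), gaussianReal_eq_withDensity (h i), withDensity_apply _ (hs i)]

/-- The Cameron–Martin formula for the standard Gaussian measure on `ℝⁿ`. -/
lemma stdGaussian_preimage_add {n : ℕ} (h : EuclideanSpace ℝ (Fin n))
    {B : Set (EuclideanSpace ℝ (Fin n))} (hB : MeasurableSet B) :
    stdGaussian (EuclideanSpace ℝ (Fin n)) ((fun z => z + h) ⁻¹' B) =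
      ∫⁻ z in B, ENNReal.ofReal (Real.exp (inner ℝ h z - ‖h‖ ^ 2 / 2))
        ∂(stdGaussian (EuclideanSpace ℝ (Fin n))) := by
  have hm : Measurable (WithLp.toLp 2 : (Fin n → ℝ) → EuclideanSpace ℝ (Fin n)) := by fun_prop
  rw [← map_pi_eq_stdGaussian, Measure.map_apply hm (hB.preimage (by fun_prop)),
    setLIntegral_map hB (by fun_prop) hm]
  have := congrArg (fun μ => μ (WithLp.toLp 2 ⁻¹' B)) (pi_gaussianReal_map_add h.ofLp)
  simp only at this
  rw [Measure.map_apply (by fun_prop) (hB.preimage hm), withDensity_apply _ (hB.preimage hm)] at this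
  refine Eq.trans ?_ (this.trans ?_)
  · rfl
  · congr 1
    ext z
    congr 2
    rw [EuclideanSpace.real_norm_sq_eq, PiLp.inner_apply, Finset.sum_sub_distrib, Finset.sum_div]
    simp [mul_comm]

lemma lintegral_exp_inner_stdGaussian {n : ℕ} (h : EuclideanSpace ℝ (Fin n)) :
    ∫⁻ z, ENNReal.ofReal (Real.exp (inner ℝ h z - ‖h‖ ^ 2 / 2))
      ∂(stdGaussian (EuclideanSpace ℝ (Fin n))) = 1 := by
  have := stdGaussian_preimage_add h MeasurableSet.univ
  simpa using this.symm

/-- Cauchy–Schwarz applied to the indicator of `B` times the Cameron–Martin density. -/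
lemma stdGaussian_preimage_add_le {n : ℕ} (h : EuclideanSpace ℝ (Fin n))
    {B : Set (EuclideanSpace ℝ (Fin n))} (hB : MeasurableSet B) :
    (stdGaussian (EuclideanSpace ℝ (Fin n))).real ((fun z => z + h) ⁻¹' B) ≤
      Real.exp (‖h‖ ^ 2 / 2) * √((stdGaussian (EuclideanSpace ℝ (Fin n))).real B) := by
  set γ := stdGaussian (EuclideanSpace ℝ (Fin n))
  set g : EuclideanSpace ℝ (Fin n) → ℝ≥0∞ :=
    fun z => ENNReal.ofReal (Real.exp (inner ℝ h z - ‖h‖ ^ 2 / 2)) with hg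
  have hgm : Measurable g := by fun_prop
  have h2 : ∫⁻ z, g z ^ (2 : ℝ) ∂γ = ENNReal.ofReal (Real.exp (‖h‖ ^ 2)) := by
    -- The squared density is a constant times the density of the shift by `2h`, which integrates to
    -- one.
    have e : ∀ z, g z ^ (2 : ℝ) = ENNReal.ofReal (Real.exp (‖h‖ ^ 2)) *
        ENNReal.ofReal (Real.exp (inner ℝ ((2 : ℝ) • h) z - ‖(2 : ℝ) • h‖ ^ 2 / 2)) := by
      intro z
      rw [← ENNReal.ofReal_mul (Real.exp_pos _).le, ← Real.exp_add, hg]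
      simp only
      rw [ENNReal.ofReal_rpow_of_pos (Real.exp_pos _), ← Real.exp_mul, real_inner_smul_left,
        norm_smul]
      congr 2
      simp
      ring
    simp_rw [e]
    rw [lintegral_const_mul _ (by fun_prop), lintegral_exp_inner_stdGaussian, mul_one]
  have hcs := ENNReal.lintegral_mul_le_Lp_mul_Lq γ Real.HolderConjugate.two_two
    (f := B.indicator 1) (g := g) ((measurable_one.indicator hB).aemeasurable) hgm.aemeasurable
  have hl : ∫⁻ z, (B.indicator (1 : EuclideanSpace ℝ (Fin n) → ℝ≥0∞) * g) z ∂γ = γ ((fun z => z + h) ⁻¹' B) := by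
    rw [stdGaussian_preimage_add h hB, ← lintegral_indicator hB]
    refine lintegral_congr fun z => ?_
    by_cases hz : z ∈ B <;> simp [hz, hg]
  have hi : ∫⁻ z, (B.indicator (1 : EuclideanSpace ℝ (Fin n) → ℝ≥0∞)) z ^ (2 : ℝ) ∂γ = γ B := by
    rw [← lintegral_indicator_one hB]
    refine lintegral_congr fun z => ?_
    by_cases hz : z ∈ B <;> simp [hz]
  rw [hl, hi, h2] at hcs
  have := ENNReal.toReal_mono (by finiteness) hcs
  rw [ENNReal.toReal_mul, ← ENNReal.toReal_rpow, ← ENNReal.toReal_rpow,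
    ENNReal.toReal_ofReal (Real.exp_pos _).le, ← Real.exp_mul, ← Real.sqrt_eq_rpow] at this
  rw [measureReal_def, measureReal_def, mul_comm]
  convert this using 3
  ring

/-- The Gaussian measure `N(v, σ² I)` on `ℝⁿ`. -/
noncomputable def gaussianLocation {n : ℕ} (σ : ℝ) (v : EuclideanSpace ℝ (Fin n)) :
    Measure (EuclideanSpace ℝ (Fin n)) :=
  (stdGaussian (EuclideanSpace ℝ (Fin n))).map (fun z => v + σ • z)

instance {n : ℕ} (σ : ℝ) (v : EuclideanSpace ℝ (Fin n)) :
    IsProbabilityMeasure (gaussianLocation σ v) :=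
  Measure.isProbabilityMeasure_map (by fun_prop)

lemma gaussianLocation_real_le {n : ℕ} {σ : ℝ} (hσ : 0 < σ) (v w : EuclideanSpace ℝ (Fin n))
    {B : Set (EuclideanSpace ℝ (Fin n))} (hB : MeasurableSet B) :
    (gaussianLocation σ v).real B ≤
      Real.exp (‖v - w‖ ^ 2 / (2 * σ ^ 2)) * √((gaussianLocation σ w).real B) := by
  have hw : Measurable fun z : EuclideanSpace ℝ (Fin n) => w + σ • z := by fun_prop
  have h := stdGaussian_preimage_add_le (σ⁻¹ • (v - w)) (hB.preimage hw)
  rw [gaussianLocation, gaussianLocation, map_measureReal_apply (by fun_prop) hB,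
    map_measureReal_apply hw hB]
  have hz : (fun z : EuclideanSpace ℝ (Fin n) => v + σ • z) =
      (fun z => w + σ • z) ∘ fun z => z + σ⁻¹ • (v - w) := by
    ext1 z
    simp only [Function.comp_apply, smul_add, smul_smul, mul_inv_cancel₀ hσ.ne', one_smul]
    abel
  have hn : ‖σ⁻¹ • (v - w)‖ ^ 2 / 2 = ‖v - w‖ ^ 2 / (2 * σ ^ 2) := by
    rw [norm_smul, mul_pow, norm_inv, Real.norm_eq_abs, inv_pow, sq_abs]
    field_simp
  rw [hz, Set.preimage_comp, ← hn]
  exact h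

/-! ### Testing and Assouad's lemma. -/

/-- No test recovers one of finitely many Gaussian means which are close to each other. -/
lemma sum_gaussianLocation_real_le {n : ℕ} {σ : ℝ} (hσ : 0 < σ) {ι : Type*} [Fintype ι]
    (hcard : 2 ≤ Fintype.card ι) (v : ι → EuclideanSpace ℝ (Fin n))
    (w : EuclideanSpace ℝ (Fin n))
    (hclose : ∀ i, ‖v i - w‖ ^ 2 ≤ σ ^ 2 * Real.log (Fintype.card ι) / 2)
    (B : ι → Set (EuclideanSpace ℝ (Fin n))) (hB : ∀ i, MeasurableSet (B i))
    (hdisj : Pairwise (Function.onFun Disjoint B)) :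
    ∑ i, (gaussianLocation σ (v i)).real (B i) ≤ 17 / 20 * Fintype.card ι := by
  set m : ℝ := (Fintype.card ι : ℝ) with hm
  have hm2 : (2 : ℝ) ≤ m := by rw [hm]; exact_mod_cast hcard
  have hm0 : 0 < m := by linarith
  set q : ℝ := Real.exp (Real.log m / 4) with hq
  have hq0 : 0 < q := Real.exp_pos _
  have hq4 : q ^ 4 = m := by
    rw [hq, ← Real.exp_nat_mul]
    push_cast
    rw [mul_div_cancel₀ _ (by norm_num), Real.exp_log hm0]
  have h1 : ∀ i, (gaussianLocation σ (v i)).real (B i) ≤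
      q * √((gaussianLocation σ w).real (B i)) := by
    intro i
    refine (gaussianLocation_real_le hσ (v i) w (hB i)).trans ?_
    gcongr
    rw [hq, Real.exp_le_exp, div_le_div_iff₀ (by positivity) (by norm_num)]
    nlinarith [hclose i]
  have h2 : ∑ i, (gaussianLocation σ w).real (B i) ≤ 1 := by
    rw [← measureReal_iUnion_fintype hdisj hB]
    exact measureReal_le_one
  have h3 : ∑ i, √((gaussianLocation σ w).real (B i)) ≤ q ^ 2 := by
    refine abs_le_of_sq_le_sq' ?_ (by positivity) |>.2
    refine (sq_sum_le_card_mul_sum_sq (s := Finset.univ)).trans ?_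
    simp_rw [Real.sq_sqrt measureReal_nonneg]
    rw [Finset.card_univ, ← hm, ← pow_mul, hq4]
    nlinarith
  -- Here `q = m^(1/4) ≥ 2^(1/4) > 20/17`, so `q³ ≤ (17/20) q⁴`.
  have h4 : 1 ≤ 17 / 20 * q := by
    by_contra hc
    have : (17 / 20 * q) ^ 4 < 1 := pow_lt_one₀ (by positivity) (not_le.1 hc) (by norm_num)
    rw [mul_pow, hq4] at this
    norm_num at this
    linarith
  calc ∑ i, (gaussianLocation σ (v i)).real (B i)
      ≤ ∑ i, q * √((gaussianLocation σ w).real (B i)) := Finset.sum_le_sum fun i _ => h1 i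
    _ ≤ q * q ^ 2 := by rw [← Finset.mul_sum]; gcongr
    _ ≤ 17 / 20 * m := by rw [← hq4]; nlinarith [pow_pos hq0 3]

lemma le_sum_gaussianLocation_real_compl {n : ℕ} {σ : ℝ} (hσ : 0 < σ) {ι : Type*} [Fintype ι]
    (hcard : 2 ≤ Fintype.card ι) (v : ι → EuclideanSpace ℝ (Fin n))
    (w : EuclideanSpace ℝ (Fin n))
    (hclose : ∀ i, ‖v i - w‖ ^ 2 ≤ σ ^ 2 * Real.log (Fintype.card ι) / 2)
    (B : ι → Set (EuclideanSpace ℝ (Fin n))) (hB : ∀ i, MeasurableSet (B i))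
    (hdisj : Pairwise (Function.onFun Disjoint B)) :
    3 / 20 * Fintype.card ι ≤ ∑ i, (gaussianLocation σ (v i)).real (B i)ᶜ := by
  have h := sum_gaussianLocation_real_le hσ hcard v w hclose B hB hdisj
  simp_rw [fun i => probReal_compl_eq_one_sub (μ := gaussianLocation σ (v i)) (hB i)]
  rw [Finset.sum_sub_distrib]
  simp
  linarith

/-- A measurable choice of a nearest point in a finite family. -/
lemma exists_measurable_nearest {E : Type*} [PseudoMetricSpace E] [MeasurableSpace E]
    [OpensMeasurableSpace E] {ι : Type*} [Finite ι] [Nonempty ι] (v : ι → E) :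
    ∃ g : E → ι, (∀ s : Set ι, MeasurableSet (g ⁻¹' s)) ∧
      ∀ y i, dist (v (g y)) y ≤ dist (v i) y := by
  classical
  obtain ⟨N, ⟨e⟩⟩ := Finite.exists_equiv_fin ι
  -- `nearestPtInd` searches the indices `0, …, N`, one too many; the default value there is still a
  -- point of the family.
  let f : ℕ → ι := fun k => if h : k < N then e.symm ⟨k, h⟩ else Classical.arbitrary ι
  refine ⟨fun y => f (SimpleFunc.nearestPtInd (v ∘ f) N y), fun s => ?_, fun y i => ?_⟩
  · exact (SimpleFunc.nearestPtInd (v ∘ f) N).measurableSet_preimage (f ⁻¹' s)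
  · have h := SimpleFunc.edist_nearestPt_le (v ∘ f) y (k := e i) (N := N) (e i).2.le
    rw [edist_dist, edist_dist, ENNReal.ofReal_le_ofReal_iff dist_nonneg] at h
    simpa [SimpleFunc.nearestPt, f] using h

/-- The map `(J, j) ↦ (update J b j, J b)` is an involution. This reduces an average over all words
to tests in the single block `b`. -/
lemma sum_update_eq {k : ℕ} {A : Type*} [Fintype A] [DecidableEq A] (b : Fin k)
    (F : (Fin k → A) → ℝ) :
    ∑ J, ∑ j, F (Function.update J b j) = Fintype.card A * ∑ J, F J := by
  have h : ∑ q : (Fin k → A) × A, F (Function.update q.1 b q.2) =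
      ∑ q : (Fin k → A) × A, F q.1 := by
    refine Finset.sum_nbij' (fun q => (Function.update q.1 b q.2, q.1 b))
      (fun q => (Function.update q.1 b q.2, q.1 b)) ?_ ?_ ?_ ?_ ?_ <;> simp
  rw [Fintype.sum_prod_type, Fintype.sum_prod_type] at h
  rw [h, Finset.mul_sum]
  simp

/-- Assouad's lemma for Gaussian means indexed by words over a finite alphabet. -/
theorem exists_le_lintegral_gaussianLocation {n k : ℕ} {σ δ : ℝ} (hσ : 0 < σ) (hδ : 0 ≤ δ)
    {A : Type*} [Fintype A] [DecidableEq A] (hcard : 2 ≤ Fintype.card A)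
    (v : (Fin k → A) → EuclideanSpace ℝ (Fin n))
    (hsep : ∀ J J', δ * hammingDist J J' ≤ ‖v J - v J'‖ ^ 2)
    (hclose : ∀ J b j, ‖v (Function.update J b j) - v J‖ ^ 2 ≤
      σ ^ 2 * Real.log (Fintype.card A) / 2)
    {f : EuclideanSpace ℝ (Fin n) → EuclideanSpace ℝ (Fin n)} (hf : Measurable f) :
    ∃ J, ENNReal.ofReal (3 / 80 * k * δ) ≤ ∫⁻ y, ‖f y - v J‖ₑ ^ 2 ∂(gaussianLocation σ (v J)) := by
  have : Nonempty A := Fintype.card_pos_iff.1 (by omega)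
  obtain ⟨g, hgm, hg⟩ := exists_measurable_nearest v
  have herr : ∀ (b : Fin k) (j : A), MeasurableSet {y | g (f y) b = j} := fun b j =>
    (hgm {J | J b = j}).preimage hf
  have havg : ∃ J, 3 / 20 * k ≤
      ∑ b, (gaussianLocation σ (v J)).real {y | g (f y) b = J b}ᶜ := by
    have hblock : ∀ b, 3 / 20 * (Fintype.card (Fin k → A) : ℝ) ≤
        ∑ J, (gaussianLocation σ (v J)).real {y | g (f y) b = J b}ᶜ := by
      intro b
      have h := sum_update_eq (A := A) b
        (fun J => (gaussianLocation σ (v J)).real {y | g (f y) b = J b}ᶜ)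
      have hJ : ∀ J : Fin k → A, 3 / 20 * (Fintype.card A : ℝ) ≤
          ∑ j, (gaussianLocation σ (v (Function.update J b j))).real
            {y | g (f y) b = (Function.update J b j) b}ᶜ := by
        intro J
        simp only [Function.update_self]
        refine le_sum_gaussianLocation_real_compl hσ hcard
          (fun j => v (Function.update J b j)) (v J) (fun j => hclose J b j)
          (fun j => {y | g (f y) b = j}) (herr b) fun i j hij => ?_
        exact Set.disjoint_left.2 fun y hi hj => hij (hi.symm.trans hj)
      have hs := Finset.sum_le_sum fun J (_ : J ∈ (Finset.univ : Finset (Fin k → A))) => hJ J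
      rw [h, Finset.sum_const, Finset.card_univ, nsmul_eq_mul] at hs
      have : (0 : ℝ) < Fintype.card A := by exact_mod_cast Fintype.card_pos
      refine le_of_mul_le_mul_left ?_ this
      linarith
    have hs := Finset.sum_le_sum fun b (_ : b ∈ (Finset.univ : Finset (Fin k))) => hblock b
    rw [Finset.sum_comm] at hs
    obtain ⟨J, -, hJ⟩ := Finset.exists_le_of_sum_le (s := Finset.univ)
      (f := fun _ : Fin k → A => 3 / 20 * (k : ℝ)) Finset.univ_nonempty (by
        refine le_trans (le_of_eq ?_) hs
        simp
        ring)
    exact ⟨J, hJ⟩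
  obtain ⟨J, hJ⟩ := havg
  refine ⟨J, ?_⟩
  -- The mean nearest to `f y` lies within `2‖f y - v J‖` of `v J`, so each misread block costs `δ /
  -- 4`.
  have hpt : ∀ y, ∑ b, ({y | g (f y) b = J b}ᶜ).indicator
      (fun _ => ENNReal.ofReal (δ / 4)) y ≤ ‖f y - v J‖ₑ ^ 2 := by
    intro y
    have e1 : ∑ b, ({y | g (f y) b = J b}ᶜ).indicator (fun _ => ENNReal.ofReal (δ / 4)) y =
        ENNReal.ofReal (δ / 4 * hammingDist (g (f y)) J) := by
      simp only [Set.indicator_apply, Set.mem_compl_iff, Set.mem_ofPred_eq]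
      rw [← Finset.sum_filter, Finset.sum_const, nsmul_eq_mul, mul_comm (δ / 4),
        ENNReal.ofReal_mul (by positivity), ENNReal.ofReal_natCast]
      rfl
    rw [e1, ← ofReal_norm, ← ENNReal.ofReal_pow (norm_nonneg _)]
    refine ENNReal.ofReal_le_ofReal ?_
    have h1 := hsep (g (f y)) J
    have h2 := hg (f y) J
    have h3 := dist_triangle (v (g (f y))) (f y) (v J)
    rw [dist_comm (f y)] at h3
    rw [dist_comm (v J), dist_eq_norm (f y) (v J)] at h2
    rw [dist_comm (v J), dist_eq_norm (f y) (v J), dist_eq_norm (v (g (f y))) (v J)] at h3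
    have h4 : ‖v (g (f y)) - v J‖ ^ 2 ≤ (2 * ‖f y - v J‖) ^ 2 := by gcongr; linarith
    linarith
  refine le_trans ?_ (lintegral_mono hpt)
  rw [lintegral_finsetSum _ fun b _ => measurable_const.indicator (herr b _).compl]
  simp_rw [fun b => lintegral_indicator_const (μ := gaussianLocation σ (v J))
    (herr b (J b)).compl (ENNReal.ofReal (δ / 4))]
  rw [← Finset.mul_sum]
  simp_rw [fun b => (ofReal_measureReal (μ := gaussianLocation σ (v J))
    (s := {y | g (f y) b = J b}ᶜ) (measure_ne_top _ _)).symm]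
  rw [← ENNReal.ofReal_sum_of_nonneg fun _ _ => measureReal_nonneg,
    ← ENNReal.ofReal_mul (by positivity)]
  refine ENNReal.ofReal_le_ofReal ?_
  nlinarith

/-! ### Sparse eigenvalues and block vectors. -/

lemma meanVec_eq_toEuclideanLin {n p : ℕ} (X : Matrix (Fin n) (Fin p) ℝ)
    (β : EuclideanSpace ℝ (Fin p)) : meanVec X β = X.toEuclideanLin β := rfl

lemma meanVec_sub {n p : ℕ} (X : Matrix (Fin n) (Fin p) ℝ) (β β' : EuclideanSpace ℝ (Fin p)) :
    meanVec X β - meanVec X β' = meanVec X (β - β') := by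
  simp only [meanVec_eq_toEuclideanLin, map_sub]

lemma bddBelow_sparseQuotients {n p : ℕ} (X : Matrix (Fin n) (Fin p) ℝ) (k : ℕ) :
    BddBelow (sparseQuotients X k) :=
  ⟨0, by rintro _ ⟨β, -, -, rfl⟩; positivity⟩

lemma bddAbove_sparseQuotients {n p : ℕ} (X : Matrix (Fin n) (Fin p) ℝ) (k : ℕ) :
    BddAbove (sparseQuotients X k) := by
  refine ⟨‖X.toEuclideanLin.toContinuousLinearMap‖ ^ 2, ?_⟩
  rintro _ ⟨β, -, -, rfl⟩
  refine div_le_of_le_mul₀ (by positivity) (by positivity) ?_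
  rw [← mul_pow]
  gcongr
  exact X.toEuclideanLin.toContinuousLinearMap.le_opNorm β

lemma phiMin_nonneg {n p : ℕ} (X : Matrix (Fin n) (Fin p) ℝ) (k : ℕ) : 0 ≤ phiMin X k :=
  Real.sInf_nonneg (by rintro _ ⟨β, -, -, rfl⟩; positivity)

lemma phiMax_nonneg {n p : ℕ} (X : Matrix (Fin n) (Fin p) ℝ) (k : ℕ) : 0 ≤ phiMax X k :=
  Real.sSup_nonneg (by rintro _ ⟨β, -, -, rfl⟩; positivity)

lemma norm_meanVec_sq_bounds {n p : ℕ} (X : Matrix (Fin n) (Fin p) ℝ) {k : ℕ}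
    {β : EuclideanSpace ℝ (Fin p)} (hβ : l0norm β ≤ k) :
    phiMin X k * ‖β‖ ^ 2 ≤ ‖meanVec X β‖ ^ 2 ∧ ‖meanVec X β‖ ^ 2 ≤ phiMax X k * ‖β‖ ^ 2 := by
  by_cases h0 : β = 0
  · simp [h0, meanVec_eq_toEuclideanLin]
  have hpos : 0 < ‖β‖ ^ 2 := by have := norm_pos_iff.2 h0; positivity
  have hmem : ‖meanVec X β‖ ^ 2 / ‖β‖ ^ 2 ∈ sparseQuotients X k := by
    refine ⟨β, ?_, hβ, rfl⟩
    exact hammingNorm_pos_iff.2 fun h => h0 (by ext i; exact congrFun h i)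
  exact ⟨(le_div_iff₀ hpos).1 (csInf_le (bddBelow_sparseQuotients X k) hmem),
    (div_le_iff₀ hpos).1 (le_csSup (bddAbove_sparseQuotients X k) hmem)⟩

/-- The vector of `ℝᵖ` with entries `u` on the image of `e`, and zero elsewhere. -/
noncomputable def extendVec {p : ℕ} {ι : Type*} (e : ι ↪ Fin p) (u : ι → ℝ) :
    EuclideanSpace ℝ (Fin p) :=
  WithLp.toLp 2 (Function.extend e u 0)

lemma extendVec_sub {p : ℕ} {ι : Type*} (e : ι ↪ Fin p) (u u' : ι → ℝ) :
    extendVec e u - extendVec e u' = extendVec e (u - u') := by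
  ext i
  by_cases hi : ∃ q, e q = i
  · obtain ⟨q, rfl⟩ := hi
    simp [extendVec, e.injective.extend_apply]
  · simp [extendVec, Function.extend_apply' _ _ _ hi]

lemma norm_extendVec_sq {p : ℕ} {ι : Type*} [Fintype ι] (e : ι ↪ Fin p) (u : ι → ℝ) :
    ‖extendVec e u‖ ^ 2 = ∑ q, u q ^ 2 := by
  rw [EuclideanSpace.real_norm_sq_eq]
  refine (Fintype.sum_of_injective e e.injective _ _ ?_ ?_).symm
  · intro i hi
    simp [extendVec, Function.extend_apply' _ _ _ hi]
  · intro q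
    simp [extendVec, e.injective.extend_apply]

lemma l0norm_extendVec_le {p : ℕ} {ι : Type*} [Fintype ι] (e : ι ↪ Fin p) (u : ι → ℝ) :
    l0norm (extendVec e u) ≤ hammingNorm u := by
  classical
  unfold l0norm hammingNorm
  rw [← Finset.card_map e]
  refine Finset.card_le_card fun i hi => ?_
  rw [Finset.mem_filter] at hi
  by_cases hq : ∃ q, e q = i
  · obtain ⟨q, rfl⟩ := hq
    simpa [extendVec, e.injective.extend_apply] using hi
  · exact absurd (by simp [extendVec, Function.extend_apply' _ _ _ hq]) hi.2

lemma hammingNorm_prod {k : ℕ} {T : Type*} [Fintype T] (u : Fin k × T → ℝ) :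
    hammingNorm u = ∑ b, hammingNorm fun t => u (b, t) := by
  classical
  simp only [hammingNorm, Finset.card_filter]
  exact Fintype.sum_prod_type _

/-! ### Minimax lower bounds. -/

/-- A lower bound on the minimax risk from a blockwise family of sparse vectors: each of the `k`
blocks of coordinates carries one of the patterns `c x`. -/
theorem le_minimaxRisk_of_blocks {n p k w : ℕ} (X : Matrix (Fin n) (Fin p) ℝ) {σ : ℝ} (hσ : 0 < σ)
    {A T : Type*} [Fintype A] [DecidableEq A] [Fintype T] (hcard : 2 ≤ Fintype.card A)
    (e : Fin k × T ↪ Fin p) (c : A → T → ℝ)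
    (hsparse : ∀ x, hammingNorm (c x) ≤ 1) (hdiff : ∀ x y, hammingNorm (c x - c y) ≤ w)
    (hlower : ∀ x y, x ≠ y → 1 ≤ ∑ t, (c x t - c y t) ^ 2)
    (hupper : ∀ x y, ∑ t, (c x t - c y t) ^ 2 ≤ 2) :
    ENNReal.ofReal (3 / 320 * σ ^ 2 * (phiMin X (k * w) / phiMax X (k * w)) *
      (k * Real.log (Fintype.card A))) ≤ minimaxRisk X σ k := by
  rcases (phiMax_nonneg X (k * w)).eq_or_lt with h0 | hpos
  -- If `φ_max = 0`, the quotient is `0` by convention and the bound is trivial.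
  · simp [← h0]
  have hlog : 0 ≤ Real.log (Fintype.card A) := Real.log_natCast_nonneg _
  set s := k * w with hs
  -- Changing one block moves the mean by at most `2 a² φ_max` in squared norm; `a` makes this
  -- exactly the closeness Assouad's lemma allows.
  set a := √(σ ^ 2 * Real.log (Fintype.card A) / (4 * phiMax X s)) with ha
  have ha2 : a ^ 2 = σ ^ 2 * Real.log (Fintype.card A) / (4 * phiMax X s) :=
    Real.sq_sqrt (by positivity)
  let β : (Fin k → A) → EuclideanSpace ℝ (Fin p) :=
    fun J => extendVec e fun q => a * c (J q.1) q.2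
  have hβsub : ∀ J J', β J - β J' = extendVec e fun q => a * (c (J q.1) q.2 - c (J' q.1) q.2) := by
    intro J J'
    rw [extendVec_sub]
    congr 1
    ext q
    simp [mul_sub]
  have hβl0 : ∀ J, l0norm (β J) ≤ k := by
    intro J
    refine (l0norm_extendVec_le _ _).trans ?_
    rw [hammingNorm_prod]
    refine (Finset.sum_le_sum fun b _ => ?_).trans_eq (b := ∑ _b : Fin k, 1) (by simp)
    refine le_trans ?_ (hsparse (J b))
    exact hammingNorm_smul_le_hammingNorm (k := a) (x := c (J b))
  have hsub_l0 : ∀ J J', l0norm (β J - β J') ≤ s := by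
    intro J J'
    rw [hβsub]
    refine (l0norm_extendVec_le _ _).trans ?_
    rw [hammingNorm_prod]
    refine (Finset.sum_le_sum fun b _ => ?_).trans_eq (b := ∑ _b : Fin k, w) (by simp [hs])
    refine le_trans ?_ (hdiff (J b) (J' b))
    exact hammingNorm_smul_le_hammingNorm (k := a) (x := c (J b) - c (J' b))
  have hnorm : ∀ J J', ‖β J - β J'‖ ^ 2 =
      a ^ 2 * ∑ b, ∑ t, (c (J b) t - c (J' b) t) ^ 2 := by
    intro J J'
    rw [hβsub, norm_extendVec_sq, Fintype.sum_prod_type]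
    simp only [mul_pow, Finset.mul_sum]
  have hham : ∀ J J' : Fin k → A,
      (hammingDist J J' : ℝ) = ∑ b, if J b ≠ J' b then (1 : ℝ) else 0 := by
    intro J J'
    rw [Finset.sum_boole]
    rfl
  refine le_iInf₂ fun f hf => ?_
  obtain ⟨J, hJ⟩ := exists_le_lintegral_gaussianLocation (σ := σ) (δ := phiMin X s * a ^ 2)
    hσ (mul_nonneg (phiMin_nonneg X s) (sq_nonneg a)) hcard (fun J => meanVec X (β J))
    (fun J J' => by
      rw [meanVec_sub]
      refine le_trans ?_ (norm_meanVec_sq_bounds X (hsub_l0 J J')).1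
      rw [hnorm, mul_assoc, hham]
      refine mul_le_mul_of_nonneg_left (mul_le_mul_of_nonneg_left
        (Finset.sum_le_sum fun b _ => ?_) (sq_nonneg a)) (phiMin_nonneg X s)
      split_ifs with h
      · exact hlower _ _ h
      · positivity)
    (fun J b j => by
      rw [meanVec_sub]
      refine (norm_meanVec_sq_bounds X (hsub_l0 _ _)).2.trans ?_
      have hle : ∑ b', ∑ t, (c (Function.update J b j b') t - c (J b') t) ^ 2 ≤ 2 := by
        rw [Finset.sum_eq_single b (fun b' _ hb' => by simp [hb']) (by simp)]
        exact hupper _ _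
      calc phiMax X s * ‖β (Function.update J b j) - β J‖ ^ 2
          ≤ phiMax X s * (a ^ 2 * 2) := by rw [hnorm]; gcongr
        _ = σ ^ 2 * Real.log (Fintype.card A) / 2 := by rw [ha2]; field_simp; norm_num) hf
  refine le_trans (le_of_eq ?_) (hJ.trans (le_iSup₂_of_le (β J) (hβl0 J) le_rfl))
  congr 1
  rw [ha2]
  field_simp
  ring

/-- With `m = ⌊p/k⌋ ≥ 2`, `p/k < m + 1 ≤ m²`, and `1 ≤ 2 log 2 ≤ 2 log m`. -/
lemma log_add_one_le {p k : ℕ} (hk : 1 ≤ k) (h : 2 * k ≤ p) :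
    Real.log ((p : ℝ) / k) + 1 ≤ 4 * Real.log ((p / k : ℕ) : ℝ) := by
  set m := p / k with hm
  have hm2 : 2 ≤ m := (Nat.le_div_iff_mul_le (by omega)).2 h
  have hm2' : (2 : ℝ) ≤ m := by exact_mod_cast hm2
  have hk0 : (0 : ℝ) < k := by exact_mod_cast hk
  have hp : (0 : ℝ) < p := by exact_mod_cast (by omega : 0 < p)
  have h1 : (p : ℝ) / k ≤ (m : ℝ) ^ 2 := by
    rw [div_le_iff₀ hk0]
    have : p < (m + 1) * k := by
      rw [mul_comm]; exact Nat.lt_mul_div_succ p (by omega)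
    have : (p : ℝ) < (m + 1) * k := by exact_mod_cast this
    nlinarith
  have h2 : Real.log ((p : ℝ) / k) ≤ 2 * Real.log m := by
    have := Real.log_le_log (by positivity) h1
    rwa [Real.log_pow, Nat.cast_ofNat] at this
  have h3 : Real.log 2 ≤ Real.log m := Real.log_le_log (by norm_num) hm2'
  linarith [Real.log_two_gt_d9]

theorem le_minimaxRisk_of_two_mul_le {n p k : ℕ} (X : Matrix (Fin n) (Fin p) ℝ) {σ : ℝ}
    (hσ : 0 < σ) (hk : 1 ≤ k) (h : 2 * k ≤ p) :
    ENNReal.ofReal (3 / 1280 * σ ^ 2 * (phiMin X (2 * k) / phiMax X (2 * k)) *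
      (k * (Real.log ((p : ℝ) / k) + 1))) ≤ minimaxRisk X σ k := by
  have hm2 : 2 ≤ p / k := (Nat.le_div_iff_mul_le (by omega)).2 h
  obtain ⟨e⟩ : Nonempty (Fin k × Fin (p / k) ↪ Fin p) := by
    refine Function.Embedding.nonempty_of_card_le ?_
    simpa using Nat.mul_div_le p k
  have hsum : ∀ x y : Fin (p / k), x ≠ y →
      ∑ t, ((Pi.single x 1 : Fin (p / k) → ℝ) t - (Pi.single y 1 : Fin (p / k) → ℝ) t) ^ 2 = 2 := by
    intro x y hxy
    have ht : ∀ t, ((Pi.single x 1 : Fin (p / k) → ℝ) t -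
        (Pi.single y 1 : Fin (p / k) → ℝ) t) ^ 2 =
        (if t = x then 1 else 0) + (if t = y then 1 else 0) := by
      intro t
      rcases eq_or_ne t x with rfl | h1
      · simp [hxy]
      · rcases eq_or_ne t y with rfl | h2
        · simp [h1]
        · simp [h1, h2]
    simp_rw [ht]
    rw [Finset.sum_add_distrib]
    simp
    norm_num
  have hone : ∀ x : Fin (p / k), hammingNorm (Pi.single x 1 : Fin (p / k) → ℝ) ≤ 1 := by
    intro x
    refine Finset.card_le_one.2 fun i hi j hj => ?_
    have hs : ∀ i, (Pi.single x 1 : Fin (p / k) → ℝ) i ≠ 0 → i = x := fun i hi => by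
      by_contra hne
      exact hi (Pi.single_eq_of_ne hne _)
    rw [hs i (Finset.mem_filter.1 hi).2, hs j (Finset.mem_filter.1 hj).2]
  have hmain := le_minimaxRisk_of_blocks (w := 2) X hσ (A := Fin (p / k)) (by simpa using hm2) e
    (fun x => Pi.single x 1) hone
    (fun x y => by
      rw [sub_eq_add_neg, add_comm, ← hammingDist_eq_hammingNorm]
      refine (hammingDist_triangle _ 0 _).trans ?_
      rw [hammingDist_zero_right, hammingDist_zero_left]
      exact add_le_add (hone y) (hone x))
    (fun x y hxy => by rw [hsum x y hxy]; norm_num)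
    (fun x y => by
      rcases eq_or_ne x y with rfl | hxy
      · simp
      · exact (hsum x y hxy).le)
  rw [Fintype.card_fin, mul_comm k 2] at hmain
  refine le_trans (ENNReal.ofReal_le_ofReal ?_) hmain
  have hratio : 0 ≤ phiMin X (2 * k) / phiMax X (2 * k) :=
    div_nonneg (phiMin_nonneg X _) (phiMax_nonneg X _)
  calc _ ≤ 3 / 1280 * σ ^ 2 * (phiMin X (2 * k) / phiMax X (2 * k)) *
        (k * (4 * Real.log ((p / k : ℕ) : ℝ))) := by gcongr; exact log_add_one_le hk h
    _ = _ := by ring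

theorem le_minimaxRisk_of_le {n p k : ℕ} (X : Matrix (Fin n) (Fin p) ℝ) {σ : ℝ}
    (hσ : 0 < σ) (h : k ≤ p) :
    ENNReal.ofReal (3 / 640 * σ ^ 2 * (phiMin X k / phiMax X k) * k) ≤ minimaxRisk X σ k := by
  obtain ⟨e⟩ : Nonempty (Fin k × Unit ↪ Fin p) :=
    Function.Embedding.nonempty_of_card_le (by simpa using h)
  have hunit : ∀ u : Unit → ℝ, hammingNorm u ≤ 1 := fun u => by
    simpa using hammingNorm_le_card_fintype (x := u)
  -- Both patterns live on the same coordinate, so differences gain no support.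
  have hmain := le_minimaxRisk_of_blocks (w := 1) X hσ (A := Bool) (by simp) e
    (fun x _ => if x then 1 else 0) (fun _ => hunit _) (fun _ _ => hunit _)
    (fun x y hxy => by cases x <;> cases y <;> simp_all)
    (fun x y => by cases x <;> cases y <;> simp)
  rw [Fintype.card_bool, mul_one] at hmain
  refine le_trans (ENNReal.ofReal_le_ofReal ?_) hmain
  have hratio : 0 ≤ phiMin X k / phiMax X k := div_nonneg (phiMin_nonneg X _) (phiMax_nonneg X _)
  have hlog : (1 / 2 : ℝ) ≤ Real.log (2 : ℕ) := by
    push_cast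
    linarith [Real.log_two_gt_d9]
  calc _ = 3 / 320 * σ ^ 2 * (phiMin X k / phiMax X k) * (k * (1 / 2)) := by ring
    _ ≤ _ := by gcongr

end SparseRegression

theorem theorem4 :
    ∃ C₂ : ℝ, 0 < C₂ ∧
      ∀ (n p : ℕ) (X : Matrix (Fin n) (Fin p) ℝ) (σ : ℝ) (p₀ : ℕ),
        0 < σ → 1 ≤ p₀ → p₀ ≤ X.rank →
          ((p₀ : ℝ) ≤ (X.rank : ℝ) / 2 →
            ENNReal.ofReal (C₂ * σ ^ 2 * SparseRegression.tau X (2 * p₀) *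
                ((p₀ : ℝ) * (Real.log ((p : ℝ) / (p₀ : ℝ)) + 1)))
              ≤ SparseRegression.minimaxRisk X σ p₀) ∧
          ((X.rank : ℝ) / 2 ≤ (p₀ : ℝ) →
            ENNReal.ofReal (C₂ * σ ^ 2 * SparseRegression.tau X p₀ * (X.rank : ℝ))
              ≤ SparseRegression.minimaxRisk X σ p₀) := by
  -- The second regime has constant 3/640 with `p₀`; passing to `r ≤ 2p₀` halves it to the constant
  -- of the first.
  refine ⟨3 / 1280, by norm_num, fun n p X σ p₀ hσ hp₀ hr => ⟨fun h => ?_, fun h => ?_⟩⟩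
  · have h2 : 2 * p₀ ≤ X.rank := by
      have : (2 : ℝ) * p₀ ≤ X.rank := by linarith
      exact_mod_cast this
    rw [SparseRegression.tau, min_eq_left h2]
    exact SparseRegression.le_minimaxRisk_of_two_mul_le X hσ hp₀ (h2.trans X.rank_le_width)
  · rw [SparseRegression.tau, min_eq_left hr]
    refine le_trans (ENNReal.ofReal_le_ofReal ?_)
      (SparseRegression.le_minimaxRisk_of_le X hσ (hr.trans X.rank_le_width))
    have hratio : 0 ≤ SparseRegression.phiMin X p₀ / SparseRegression.phiMax X p₀ :=
      div_nonneg (SparseRegression.phiMin_nonneg X _) (SparseRegression.phiMax_nonneg X _)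
    calc _ ≤ 3 / 1280 * σ ^ 2 * (SparseRegression.phiMin X p₀ / SparseRegression.phiMax X p₀) *
          (2 * p₀) := by gcongr; linarith
      _ = _ := by ring
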